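/- **Setting.** Functions live on $\mathbb R_+=[0,\infty)$; $(\Delta_\xi f)(t)=f(t+\xi)$, and kernels may be singular at $0$. Fix $\eta\ge 0$, $\lambda\ge 0$, $\rho\in[-1,1]$. *Admissible kernels.* $K\in\mathcal L^2_{loc}(\mathbb R_+,\mathbb R)$ is called admissible with constant $\gamma\in(0,2]$ and locally bounded function $c:\mathbb R_+\to\mathbb R_+$ if (i) $\int_0^{\xi}|K(t)|^2dt+\int_0^{T-\xi}|K(t+\xi)-K(t)|^2dt\le c(T)\,\xi^{\gamma}$ for all $0<\xi\le T$; (ii) for every $\xi\ge0$ the kernel $\Delta_\xi K$ is non-identically zero, non-negative, non-increasing and continuous on $(0,\infty)$, and has a resolvent of the first kind (a locally finite measure $L$ on $\mathbb R_+$ with $\Delta_\xi K*L=1$, where $(f*L)(t)=\int_{[0,t]}f(t-s)L(ds)$) that is non-negative and such that $s\mapsto L([s,s+t])$ is non-increasing on $\mathbb R_+$ for every $t>0$. For such $K$, with resolvent of the first kind $L$, let $\mathcal G_K$ be the set of real functions $g$ on $\mathbb R_+$ that are locally Hölder continuous of every order less than $\gamma/2$, with $g(0)\ge 0$ and, for all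 $\xi,t\ge0$, $$g(t+\xi)-(\Delta_\xi K*L)(0)\,g(t)-\int_{(0,t]}g(t-s)\,d(\Delta_\xi K*L)(s)\ge0 .$$ Let $\mathcal G_K^*$ be the set of bounded measurable compactly supported $h:\mathbb R_+\to\mathbb C$ such that $t\mapsto-\mathrm{Re}\int_0^\infty h(\xi)K(t+\xi)\,d\xi$ belongs to $\mathcal G_K$. *Riccati equation.* Let $\mathcal R(w,\varphi)=\tfrac12(w^2-w)+\big(\rho\eta w-\lambda+\tfrac{\eta^2}{2}\varphi\big)\varphi$. A solution of the Riccati equation with kernel $K$ and initial condition $h$ is a function $\Psi:\mathbb R_+^2\to\mathbb C$ such that $\Psi(t,\cdot)K$ is integrable for every $t\ge0$ and, for all $t,\xi\ge0$, $$\Psi(t,\xi)=h(\xi-t)\mathbf 1_{\{\xi\ge t\}}+\mathcal R\Big(w,\int_0^\infty\Psi(t-\xi,z)K(z)\,dz\Big)\mathbf 1_{\{\xi<t\}} .$$ **Lemma.** Let $K$ be an admissible kernel (with some constant and function of its own) and let $(K^n)_{n\ge1}$ be kernels that are all admissible with one common constant $\gamma$ and one common function $c$, such that $K^n\to K$ in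 $\mathcal L^2_{loc}$. Fix $T\ge0$, $M\ge0$ and $w\in\mathbb C$ with $\mathrm{Re}(w)\in[0,1]$. Let $h\in\mathcal G^*_K$ and $h^n\in\mathcal G^*_{K^n}$ ($n\ge1$) all be supported in $[0,M]$, with $h^n\to h$ uniformly on $[0,M]$. Let $\Psi$ (resp. $\Psi^n$) be a solution of the Riccati equation with kernel $K$ (resp. $K^n$) and initial condition $h$ (resp. $h^n$), and set $$\psi(t)=\int_0^\infty\Psi(t,\xi)K(\xi)\,d\xi,\qquad \psi^n(t)=\int_0^\infty\Psi^n(t,\xi)K^n(\xi)\,d\xi .$$ Then $\psi$ and all $\psi^n$ are continuous on $[0,T]$ and $\psi^n\to\psi$ in $\mathcal C[0,T]$, i.e. uniformly on $[0,T]$. Moreover, with $\widetilde M=M+T$, for all $n\ge1$ and $t\in[0,T]$ the functions $\Psi^n(t,\cdot)$ and $\Psi(t,\cdot)$ are supported in $[0,\widetilde M]$ and are bounded and measurable there, and $\Psi^n(t,\xi)\to\Psi(t,\xi)$ uniformly in $(t,\xi)\in[0,T]\times[0,\widetilde M]$. -/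

import Mathlib

open MeasureTheory Set Filter Topology
open scoped NNReal ENNReal

noncomputable section

namespace VolterraHeston

/-! Functions on `ℝ₊ = [0, ∞)` are represented by functions on `ℝ`; only their values on
`[0, ∞)` are ever used.  Kernels may be singular at `0`, so pointwise conditions on a kernel are
imposed on `(0, ∞)`. -/

/-- The shift `Δ_ξ f = f (· + ξ)`. -/
def shift (ξ : ℝ) (f : ℝ → ℝ) : ℝ → ℝ := fun t => f (t + ξ)

/-- `f` is locally square integrable on `ℝ₊`. -/
def MemL2loc (f : ℝ → ℝ) : Prop :=
  ∀ T : ℝ, MemLp f 2 (volume.restrict (Icc 0 T))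

/-- The support in `ℝ₊` of a function on `ℝ₊`. -/
def suppPos (f : ℝ → ℂ) : Set ℝ := closure {x : ℝ | 0 ≤ x ∧ f x ≠ 0}

/-- `f` is a bounded (measurable) complex-valued function on `s`. -/
def MemB (s : Set ℝ) (f : ℝ → ℂ) : Prop :=
  AEStronglyMeasurable f (volume.restrict s) ∧ ∃ C : ℝ, ∀ x ∈ s, ‖f x‖ ≤ C

/-- `f` is a bounded (measurable) complex-valued function on `ℝ₊` with compact support. -/
def MemBc (f : ℝ → ℂ) : Prop :=
  MemB (Ici 0) f ∧ IsCompact (suppPos f)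

/-- `g` is locally Hölder continuous on `ℝ₊` of any order less than `b`. -/
def MemHolder (b : ℝ) (g : ℝ → ℝ) : Prop :=
  ∀ β : ℝ≥0, 0 < β → (β : ℝ) < b → ∀ T : ℝ, ∃ C : ℝ≥0, HolderOnWith C β g (Icc 0 T)

/-- `K` satisfies
`∫₀^ξ |K(t)|² dt + ∫₀^{T-ξ} |K(t+ξ) - K(t)|² dt ≤ c(T) ξ^γ` for all `0 < ξ ≤ T`,
where `γ ∈ (0, 2]` and `c : ℝ₊ → ℝ₊` is locally bounded. -/
structure KernelRegular (γ : ℝ) (c : ℝ → ℝ) (K : ℝ → ℝ) : Prop where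
  gamma_pos : 0 < γ
  gamma_le : γ ≤ 2
  c_nonneg : ∀ T : ℝ, 0 ≤ T → 0 ≤ c T
  c_locBdd : ∀ T : ℝ, BddAbove (c '' Icc 0 T)
  bound : ∀ T ξ : ℝ, 0 < ξ → ξ ≤ T →
    (∫ t in Ioc 0 ξ, |K t| ^ 2) + (∫ t in Ioc 0 (T - ξ), |K (t + ξ) - K t| ^ 2) ≤ c T * ξ ^ γ

/-- The non-negative locally finite measure `L` on `ℝ₊` is a resolvent of the first kind of `K`:
`K * L = 1` (an identity of locally integrable functions; `K` need not be finite at `0`). -/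
structure IsResolventFirstKind (K : ℝ → ℝ) (L : Measure ℝ) : Prop where
  locallyFinite : IsLocallyFiniteMeasure L
  supported : L (Iio 0) = 0
  conv_eq_one : ∀ᵐ t ∂(volume.restrict (Ioi (0 : ℝ))), ∫ s in Icc 0 t, K (t - s) ∂L = 1

/-- `K` is non-identically zero, non-negative, non-increasing and continuous on `(0, ∞)` and has a
non-negative resolvent of the first kind `L` such that `s ↦ L([s, s+t])` is non-increasing on `ℝ₊`
for every `t > 0`. -/
structure KernelMonotone (K : ℝ → ℝ) : Prop where
  nonzero : ∃ t : ℝ, 0 < t ∧ K t ≠ 0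
  nonneg : ∀ t : ℝ, 0 < t → 0 ≤ K t
  antitone : AntitoneOn K (Ioi 0)
  continuous : ContinuousOn K (Ioi 0)
  resolvent : ∃ L : Measure ℝ, IsResolventFirstKind K L ∧
    ∀ t : ℝ, 0 < t → AntitoneOn (fun s => L (Icc s (s + t))) (Ici 0)

/-- `K ∈ L²_loc` belongs to the class `𝒦`, with constant `γ` and function `c`, and all its shifts
`Δ_ξ K`, `ξ ≥ 0`, satisfy the monotonicity condition. -/
structure IsAdmissibleKernel (γ : ℝ) (c : ℝ → ℝ) (K : ℝ → ℝ) : Prop where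
  memL2loc : MemL2loc K
  regular : KernelRegular γ c K
  monotone : ∀ ξ : ℝ, 0 ≤ ξ → KernelMonotone (shift ξ K)

/-- The function `Δ_ξ K * L` on `ℝ₊`. -/
def shiftConv (K : ℝ → ℝ) (L : Measure ℝ) (ξ t : ℝ) : ℝ :=
  ∫ s in Icc 0 t, shift ξ K (t - s) ∂L

/-- The (real-valued, locally bounded) measure `dF` on `(0, ∞)` associated with a right-continuous
function `F` of locally bounded variation on `ℝ₊` is `μ - ν`: `F(t) = F(0) + (μ - ν)((0, t])`. -/
structure IsDifferential (F : ℝ → ℝ) (μ ν : Measure ℝ) : Prop where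
  locallyFinite_pos : IsLocallyFiniteMeasure μ
  locallyFinite_neg : IsLocallyFiniteMeasure ν
  eq : ∀ t : ℝ, 0 ≤ t → F t = F 0 + (μ.real (Ioc 0 t) - ν.real (Ioc 0 t))

/-- The set `𝒢_K` (`γ` being the constant associated with `K`): `g ∈ H^{γ/2}`, `g(0) ≥ 0` and
`Δ_ξ g - (Δ_ξ K * L)(0) g - d(Δ_ξ K * L) * g ≥ 0` for all `ξ`, where `L` is the resolvent of the
first kind of `K`.  For `ξ = 0` the last condition is void, since `K * L = 1`. -/
def MemG (γ : ℝ) (K : ℝ → ℝ) (g : ℝ → ℝ) : Prop :=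
  MemHolder (γ / 2) g ∧ 0 ≤ g 0 ∧
  ∃ L : Measure ℝ, IsResolventFirstKind K L ∧
    ∀ ξ : ℝ, 0 < ξ → ∃ μ ν : Measure ℝ, IsDifferential (shiftConv K L ξ) μ ν ∧
      ∀ t : ℝ, 0 ≤ t →
        0 ≤ shift ξ g t - shiftConv K L ξ 0 * g t
          - ((∫ s in Ioc 0 t, g (t - s) ∂μ) - ∫ s in Ioc 0 t, g (t - s) ∂ν)

/-- The dual set `𝒢*_K`: bounded compactly supported `h : ℝ₊ → ℂ` such that
`t ↦ -Re ∫₀^∞ h(ξ) K(t + ξ) dξ` belongs to `𝒢_K`. -/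
def MemGstar (γ : ℝ) (K : ℝ → ℝ) (h : ℝ → ℂ) : Prop :=
  MemBc h ∧ MemG γ K (fun t => -(∫ ξ in Ioi (0 : ℝ), h ξ * (K (t + ξ) : ℂ)).re)

/-- `R(w, φ) = (w² - w)/2 + (ρ η w - λ + (η²/2) φ) φ`. -/
def riccatiR (ρ η lam : ℝ) (w φ : ℂ) : ℂ :=
  (w ^ 2 - w) / 2 + ((ρ : ℂ) * η * w - lam + (η : ℂ) ^ 2 / 2 * φ) * φ

/-- `ψ(t) = ∫₀^∞ Ψ(t, ξ) K(ξ) dξ`. -/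
def psi (K : ℝ → ℝ) (Ψ : ℝ → ℝ → ℂ) (t : ℝ) : ℂ :=
  ∫ ξ in Ioi (0 : ℝ), Ψ t ξ * (K ξ : ℂ)

/-- `Ψ` solves the Riccati equation with kernel `K` and initial condition `h`: for all `t, ξ ≥ 0`
`Ψ(t, ξ) = h(ξ - t) 1_{ξ ≥ t} + R(w, ∫₀^∞ Ψ(t - ξ, z) K(z) dz) 1_{ξ < t}`,
the integrals being well defined. -/
structure IsRiccatiSolution (ρ η lam : ℝ) (w : ℂ) (K : ℝ → ℝ) (h : ℝ → ℂ) (Ψ : ℝ → ℝ → ℂ) :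
    Prop where
  integrable : ∀ t : ℝ, 0 ≤ t → IntegrableOn (fun z => Ψ t z * (K z : ℂ)) (Ioi 0)
  eq : ∀ t ξ : ℝ, 0 ≤ t → 0 ≤ ξ →
    Ψ t ξ = if ξ < t then riccatiR ρ η lam w (psi K Ψ (t - ξ)) else h (ξ - t)

end VolterraHeston

end

open VolterraHeston

/-! The Riccati equation says that $\Psi(t,\xi)=\varphi(t-\xi)$ for one function $\varphi$ of one
variable, equal to $h(-s)$ for $s\le 0$ and to $\mathcal R(w,\psi(s))$ for $s>0$, so that
$\psi=\varphi*K$. On $[0,T]$ only $\varphi$ on $[-M,T]$ and $K$ on $(0,M+T]$ matter, and everything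
reduces to convolutions of integrable functions on the line.

Regularity of one solution. Since $K$ is non-increasing and not zero, it is bounded below near $0$,
and integrability of $\Psi(t,\cdot)K$ makes $\varphi$ integrable (`integrable_truncProfile`). As
$\mathcal R$ is quadratic, Cauchy–Schwarz gives $|\varphi|\le a+b\,|\varphi|*K^2$ with $b$
proportional to $\|\varphi\|_1$. This is linear in $|\varphi|$ with an integrable kernel, so a
convolution Gronwall inequality bounds $\varphi$ (`ae_norm_truncProfile_le`), and then $\psi$ is
continuous.

Stability. $\mathcal R$ is only locally Lipschitz, so $\psi^n$ is compared with $\psi$ as long as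
they differ by at most $1$. In the norm weighted by $e^{-lt}$ with $l$ large, the convolution
operator has a small norm, and the difference is controlled by the errors in $h^n$ and $K^n$. For
large $n$ this bound is below $1$, so by continuity the difference never reaches $1$
(`le_of_weighted_step`, `tendstoUniformlyOn_psi`). Convergence of $\Psi^n$ follows through the
formula for $\varphi$. -/

namespace VolterraHeston

/-! ### Exponential weights, convolutions and Gronwall inequalities -/

/-- The exponential weight `e^{-lt}` as an extended non-negative number. -/
noncomputable def expWeight (l t : ℝ) : ℝ≥0∞ := ENNReal.ofReal (Real.exp (-(l * t)))

theorem measurable_expWeight (l : ℝ) : Measurable (expWeight l) := by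
  unfold expWeight; fun_prop

theorem expWeight_add (l s t : ℝ) : expWeight l (s + t) = expWeight l s * expWeight l t := by
  unfold expWeight
  rw [← ENNReal.ofReal_mul (Real.exp_pos _).le, ← Real.exp_add]
  ring_nf

theorem expWeight_neg_mul_self (l t : ℝ) : expWeight l (-t) * expWeight l t = 1 := by
  rw [← expWeight_add]; simp [expWeight]

theorem expWeight_le {l : ℝ} (hl : 0 ≤ l) {s t : ℝ} (hst : s ≤ t) :
    expWeight l t ≤ expWeight l s := by
  unfold expWeight
  gcongr

theorem expWeight_ne_top (l t : ℝ) : expWeight l t ≠ ∞ := ENNReal.ofReal_ne_top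

/-- An exponential weight makes the `L¹` norm of a function on `(0, ∞)` arbitrarily small. -/
theorem exists_lintegral_expWeight_mul_le {k : ℝ → ℝ≥0∞} (hk : AEMeasurable k)
    (hkint : ∫⁻ x, k x ≠ ∞) (hk0 : ∀ x ≤ 0, k x = 0) {ε : ℝ≥0∞} (hε : 0 < ε) :
    ∃ l : ℝ, 0 ≤ l ∧ ∫⁻ x, expWeight l x * k x ≤ ε := by
  have key : Tendsto (fun n : ℕ => ∫⁻ x, expWeight n x * k x) atTop (𝓝 (∫⁻ _ : ℝ, 0)) := by
    refine tendsto_lintegral_of_dominated_convergence' k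
      (fun n => (measurable_expWeight _).aemeasurable.mul hk) (fun n => ?_) hkint ?_
    · refine ae_of_all _ fun x => ?_
      rcases le_or_gt x 0 with hx | hx
      · simp [hk0 x hx]
      · have : expWeight n x ≤ 1 := by
          have := expWeight_le (Nat.cast_nonneg (α := ℝ) n) hx.le
          simpa [expWeight] using this
        exact mul_le_of_le_one_left (zero_le) this
    · filter_upwards [ae_lt_top' hk hkint] with x hx
      rcases le_or_gt x 0 with hx0 | hx0
      · simp [hk0 x hx0]
      · have h1 : Tendsto (fun n : ℕ => expWeight n x) atTop (𝓝 0) := by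
          unfold expWeight
          rw [← ENNReal.ofReal_zero]
          refine ENNReal.tendsto_ofReal (Real.tendsto_exp_neg_atTop_nhds_zero.comp ?_)
          exact tendsto_natCast_atTop_atTop.atTop_mul_const hx0
        simpa using ENNReal.Tendsto.mul_const h1 (Or.inr hx.ne)
  rw [lintegral_zero] at key
  obtain ⟨n, hn⟩ := ((tendsto_order.1 key).2 ε hε).exists
  exact ⟨n, Nat.cast_nonneg n, hn.le⟩

theorem aemeasurable_comp_sub {f : ℝ → ℝ≥0∞} (hf : AEMeasurable f) :
    AEMeasurable (fun p : ℝ × ℝ => f (p.1 - p.2)) (volume.prod volume) :=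
  hf.comp_quasiMeasurePreserving (quasiMeasurePreserving_sub volume volume)

theorem aemeasurable_comp_sub_left {f : ℝ → ℝ≥0∞} (hf : AEMeasurable f) (t : ℝ) :
    AEMeasurable (fun x : ℝ => f (t - x)) :=
  hf.comp_quasiMeasurePreserving (Measure.measurePreserving_sub_left volume t).quasiMeasurePreserving

theorem ae_comp_sub_left {p : ℝ → Prop} (hp : ∀ᵐ s, p s) (t : ℝ) : ∀ᵐ x, p (t - x) :=
  (Measure.measurePreserving_sub_left volume t).quasiMeasurePreserving.ae hp

theorem lintegral_lintegral_comp_sub_mul {f k : ℝ → ℝ≥0∞} (hf : AEMeasurable f)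
    (hk : AEMeasurable k) :
    ∫⁻ t, ∫⁻ x, f (t - x) * k x = (∫⁻ s, f s) * ∫⁻ x, k x := by
  rw [lintegral_lintegral_swap ((aemeasurable_comp_sub hf).mul hk.comp_snd),
    ← lintegral_const_mul'' _ hk]
  refine lintegral_congr fun x => ?_
  have hfx : AEMeasurable (fun t : ℝ => f (t - x)) :=
    hf.comp_quasiMeasurePreserving (measurePreserving_sub_right volume x).quasiMeasurePreserving
  rw [lintegral_mul_const'' _ hfx, lintegral_sub_right_eq_self]

/-- A Gronwall inequality for integrable functions and convolution kernels. -/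
theorem exists_ae_le_of_le_add_mul_lintegral {f k : ℝ → ℝ≥0∞} (hf : AEMeasurable f)
    (hk : AEMeasurable k) (hfint : ∫⁻ x, f x ≠ ∞) (hkint : ∫⁻ x, k x ≠ ∞)
    (hk0 : ∀ x ≤ 0, k x = 0) {M T : ℝ} (hf0 : ∀ s, s ∉ Icc (-M) T → f s = 0) {a b : ℝ≥0∞}
    (ha : a ≠ ∞) (hb : b ≠ ∞)
    (hle : ∀ t ∈ Icc (-M) T, f t ≤ a + b * ∫⁻ x, f (t - x) * k x) :
    ∃ C : ℝ≥0∞, C ≠ ∞ ∧ ∀ᵐ t, f t ≤ C := by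
  -- The weighted mass of `k` is to be at most $1/(2b)$; for $b=0$ this threshold is $\infty$.
  have hε : (0 : ℝ≥0∞) < 2⁻¹ * b⁻¹ := by
    simp [pos_iff_ne_zero, hb]
  obtain ⟨l, hl, hlk⟩ := exists_lintegral_expWeight_mul_le hk hkint hk0 hε
  -- Half of `A` absorbs the weighted constant term and the other half absorbs the convolution of
  -- `A` with `kl`, so the excess `W` (truncated subtraction) satisfies a homogeneous inequality.
  set A : ℝ≥0∞ := 2 * (a * expWeight l (-M)) with hA
  have hAtop : A ≠ ∞ := by
    have := expWeight_ne_top l (-M)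
    finiteness
  set kl : ℝ → ℝ≥0∞ := fun x => expWeight l x * k x with hkl
  have hklm : AEMeasurable kl := (measurable_expWeight _).aemeasurable.mul hk
  have hbk : b * ∫⁻ x, kl x ≤ 2⁻¹ := by
    calc b * ∫⁻ x, kl x ≤ b * (2⁻¹ * b⁻¹) := by gcongr
      _ = 2⁻¹ * (b * b⁻¹) := by ring
      _ ≤ 2⁻¹ * 1 := by gcongr; exact ENNReal.mul_inv_le_one b
      _ = 2⁻¹ := mul_one _
  set W : ℝ → ℝ≥0∞ := fun t => expWeight l t * f t - A with hW
  have hWm : AEMeasurable W := ((measurable_expWeight _).aemeasurable.mul hf).sub_const A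
  have hWle : ∀ t, W t ≤ b * ∫⁻ x, W (t - x) * kl x := by
    intro t
    by_cases ht : t ∈ Icc (-M) T
    · refine tsub_le_iff_left.2 ?_
      have e1 : expWeight l t * ∫⁻ x, f (t - x) * k x
          = ∫⁻ x, (expWeight l (t - x) * f (t - x)) * kl x := by
        rw [← lintegral_const_mul' _ _ (expWeight_ne_top l t)]
        refine lintegral_congr fun x => ?_
        have : expWeight l t = expWeight l (t - x) * expWeight l x := by
          rw [← expWeight_add]; simp
        rw [this, hkl]; ring
      calc expWeight l t * f t
          ≤ expWeight l t * (a + b * ∫⁻ x, f (t - x) * k x) := by gcongr; exact hle t ht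
        _ = a * expWeight l t + b * ∫⁻ x, (expWeight l (t - x) * f (t - x)) * kl x := by
            rw [← e1]; ring
        _ ≤ a * expWeight l (-M) + b * ∫⁻ x, (A + W (t - x)) * kl x := by
            gcongr with x
            · exact expWeight_le hl ht.1
            · exact le_add_tsub
        _ = a * expWeight l (-M) + A * (b * ∫⁻ x, kl x) + b * ∫⁻ x, W (t - x) * kl x := by
            simp_rw [add_mul]
            rw [lintegral_add_left' (hklm.const_mul A), lintegral_const_mul'' _ hklm]
            ring
        _ ≤ a * expWeight l (-M) + A * 2⁻¹ + b * ∫⁻ x, W (t - x) * kl x := by gcongr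
        _ = A + b * ∫⁻ x, W (t - x) * kl x := by
            congr 1
            have : A * 2⁻¹ = a * expWeight l (-M) := by
              rw [hA, mul_comm (2 : ℝ≥0∞), mul_assoc, ENNReal.mul_inv_cancel (by simp) (by simp),
                mul_one]
            rw [this, hA]; ring
    · simp [hW, hf0 t ht]
  -- Finiteness, which comes from integrability of `f`, is what allows $\int W\le\frac12\int W$ to
  -- force $\int W=0$.
  have hWfin : ∫⁻ t, W t ≠ ∞ := by
    have : ∫⁻ t, W t ≤ expWeight l (-M) * ∫⁻ t, f t := by
      rw [← lintegral_const_mul'' _ hf]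
      refine lintegral_mono fun t => tsub_le_self.trans ?_
      by_cases ht : t ∈ Icc (-M) T
      · dsimp only; gcongr; exact expWeight_le hl ht.1
      · simp [hf0 t ht]
    exact ne_top_of_le_ne_top (ENNReal.mul_ne_top (expWeight_ne_top _ _) hfint) this
  have hWhalf : ∫⁻ t, W t ≤ 2⁻¹ * ∫⁻ t, W t := by
    calc ∫⁻ t, W t ≤ ∫⁻ t, b * ∫⁻ x, W (t - x) * kl x := lintegral_mono hWle
      _ = b * ((∫⁻ t, W t) * ∫⁻ x, kl x) := by
          rw [lintegral_const_mul' _ _ hb, lintegral_lintegral_comp_sub_mul hWm hklm]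
      _ = (b * ∫⁻ x, kl x) * ∫⁻ t, W t := by ring
      _ ≤ 2⁻¹ * ∫⁻ t, W t := by gcongr
  have hW0 : ∫⁻ t, W t = 0 := by
    by_contra h0
    have h1 := ENNReal.half_lt_self h0 hWfin
    rw [ENNReal.div_eq_inv_mul] at h1
    exact absurd hWhalf (not_le.2 h1)
  refine ⟨expWeight l (-T) * A, ENNReal.mul_ne_top (expWeight_ne_top _ _) hAtop, ?_⟩
  filter_upwards [(lintegral_eq_zero_iff' hWm).1 hW0] with t ht
  have ht' : expWeight l t * f t ≤ A := tsub_eq_zero_iff_le.1 ht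
  by_cases hmem : t ∈ Icc (-M) T
  · calc f t = expWeight l (-t) * (expWeight l t * f t) := by
          rw [← mul_assoc, expWeight_neg_mul_self, one_mul]
      _ ≤ expWeight l (-T) * A := by
          gcongr
          exact expWeight_le hl (neg_le_neg hmem.2)
  · simp [hf0 t hmem]

/-- Cauchy–Schwarz after writing $fk=f^{1/2}\cdot f^{1/2}k$. The right side is linear in `f` once
its mass is known, which linearises the quadratic Riccati estimate. -/
theorem lintegral_mul_sq_le {f k : ℝ → ℝ≥0∞} (hf : AEMeasurable f) (hk : AEMeasurable k) :
    (∫⁻ x, f x * k x) ^ 2 ≤ (∫⁻ x, f x) * ∫⁻ x, f x * k x ^ 2 := by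
  have h1 := ENNReal.lintegral_mul_le_Lp_mul_Lq volume Real.HolderConjugate.two_two
    (hf.pow_const (1 / 2 : ℝ)) ((hf.pow_const (1 / 2 : ℝ)).mul hk)
  have e0 : ∀ y : ℝ≥0∞, y ^ (1 / 2 : ℝ) * y ^ (1 / 2 : ℝ) = y := fun y => by
    rw [← ENNReal.rpow_add_of_nonneg _ _ (by norm_num) (by norm_num)]; norm_num
  have e2 : ∀ y : ℝ≥0∞, (y ^ (1 / 2 : ℝ)) ^ (2 : ℕ) = y := fun y => by rw [pow_two, e0]
  simp only [Pi.mul_apply, ENNReal.rpow_two, mul_pow, e2, ← mul_assoc, e0] at h1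
  calc (∫⁻ x, f x * k x) ^ 2 ≤ _ := pow_le_pow_left' h1 2
    _ = _ := by rw [mul_pow, e2, e2]

/-- The convolution of an integrable function with an essentially bounded one is continuous. -/
theorem continuous_integral_comp_sub_mul {f g : ℝ → ℂ} (hf : Integrable f) {B : ℝ}
    (hB : ∀ᵐ s, ‖f s‖ ≤ B) (hg : Integrable g) :
    Continuous fun t => ∫ x, f (t - x) * g x := by
  have hfm : ∀ t, AEStronglyMeasurable (fun x => f (t - x)) := fun t =>
    hf.aestronglyMeasurable.comp_quasiMeasurePreserving
      (Measure.measurePreserving_sub_left volume t).quasiMeasurePreserving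
  have hint : ∀ {g : ℝ → ℂ}, Integrable g → ∀ t, Integrable fun x => f (t - x) * g x :=
    fun hg t => hg.bdd_mul (hfm t) (ae_comp_sub_left hB t)
  have hB0 : 0 ≤ B := by
    obtain ⟨s, hs⟩ := hB.exists
    exact (norm_nonneg _).trans hs
  refine continuous_of_uniform_approx_of_continuous fun u hu => ?_
  obtain ⟨ε, hε, hεu⟩ := Metric.mem_uniformity_dist.1 hu
  -- Replacing `g` by a continuous compactly supported `k` changes the convolution by at most
  -- $B\|g-k\|_1$ uniformly in `t`; `B + 1` avoids division by zero.
  obtain ⟨k, hkc, hkle, hkcont, hkint⟩ :=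
    hg.exists_hasCompactSupport_integral_sub_le (ε := ε / (2 * (B + 1))) (by positivity)
  refine ⟨fun t => ∫ x, f (t - x) * k x, ?_, fun t => hεu ?_⟩
  · have := hkc.continuous_convolution_left (ContinuousLinearMap.mul ℝ ℂ) (μ := volume) hkcont
      hf.locallyIntegrable
    refine this.congr fun t => ?_
    simp only [convolution_def, ContinuousLinearMap.mul_apply']
    exact integral_congr_ae (ae_of_all _ fun x => mul_comm _ _)
  · rw [dist_eq_norm, ← integral_sub (hint hg t) (hint hkint t)]
    calc ‖∫ x, (f (t - x) * g x - f (t - x) * k x)‖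
        ≤ ∫ x, B * ‖g x - k x‖ := by
          refine norm_integral_le_of_norm_le ((hg.sub hkint).norm.const_mul B) ?_
          filter_upwards [ae_comp_sub_left hB t] with x hx
          rw [← mul_sub, norm_mul]
          gcongr
      _ = B * ∫ x, ‖g x - k x‖ := integral_const_mul _ _
      _ ≤ B * (ε / (2 * (B + 1))) := by gcongr
      _ < ε := by
          rw [mul_div_assoc', div_lt_iff₀ (by positivity)]
          nlinarith

/-- A weighted Gronwall estimate that is only assumed as long as the function stays below `1`. -/
theorem le_of_weighted_step {d : ℝ → ℝ} {T l ε : ℝ} (hd : ContinuousOn d (Icc 0 T))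
    (hl : 0 ≤ l) (hε : 0 ≤ ε) (hsmall : 2 * ε * Real.exp (l * T) < 1)
    (hstep : ∀ t ∈ Icc 0 T, (∀ s ∈ Ico 0 t, d s ≤ 1) → ∀ D : ℝ, 0 ≤ D →
      (∀ s ∈ Ico 0 t, d s ≤ D * Real.exp (l * s)) → d t ≤ (ε + D / 2) * Real.exp (l * t)) :
    ∀ t ∈ Icc 0 T, d t ≤ 2 * ε * Real.exp (l * T) := by
  have main : ∀ τ ∈ Icc 0 T, (∀ s ∈ Ico 0 τ, d s ≤ 1) → d τ ≤ 2 * ε * Real.exp (l * T) := by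
    intro τ hτ hlt
    have hcont : ContinuousOn (fun s => d s * Real.exp (-(l * s))) (Icc 0 τ) :=
      (hd.mono (Icc_subset_Icc_right hτ.2)).mul (by fun_prop)
    -- At a maximum point of the weighted function, the step hypothesis applied with its own maximum
    -- gives $D\le\varepsilon+D/2$, hence $D\le 2\varepsilon$. Since `d` may be negative, `D` is cut
    -- off at $0$.
    obtain ⟨t, ht, hmax⟩ := isCompact_Icc.exists_isMaxOn (nonempty_Icc.2 hτ.1) hcont
    have hexp : ∀ s, Real.exp (-(l * s)) * Real.exp (l * s) = 1 := fun s => by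
      rw [← Real.exp_add]; simp
    set D := max (d t * Real.exp (-(l * t))) 0 with hD
    have hle : ∀ s ∈ Icc 0 τ, d s ≤ D * Real.exp (l * s) := by
      intro s hs
      calc d s = (d s * Real.exp (-(l * s))) * Real.exp (l * s) := by rw [mul_assoc, hexp, mul_one]
        _ ≤ D * Real.exp (l * s) := by
          gcongr
          exact (hmax hs).trans (le_max_left _ _)
    have h1 := hstep t ⟨ht.1, ht.2.trans hτ.2⟩
      (fun s hs => hlt s ⟨hs.1, hs.2.trans_le ht.2⟩) D (le_max_right _ _)
      (fun s hs => hle s ⟨hs.1, hs.2.le.trans ht.2⟩)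
    have h2 : d t * Real.exp (-(l * t)) ≤ ε + D / 2 := by
      calc d t * Real.exp (-(l * t))
          ≤ ((ε + D / 2) * Real.exp (l * t)) * Real.exp (-(l * t)) := by gcongr
        _ = ε + D / 2 := by rw [mul_assoc, mul_comm (Real.exp (l * t)), hexp, mul_one]
    have hD0 : 0 ≤ D := le_max_right _ _
    have h3 : D ≤ 2 * ε := by
      rcases le_total (d t * Real.exp (-(l * t))) 0 with h | h
      · rw [hD, max_eq_right h]; positivity
      · have : D = d t * Real.exp (-(l * t)) := max_eq_left h
        linarith
    calc d τ ≤ D * Real.exp (l * τ) := hle τ ⟨hτ.1, le_rfl⟩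
      _ ≤ 2 * ε * Real.exp (l * T) := by
        gcongr
        exact hτ.2
  have hbelow : ∀ t ∈ Icc 0 T, d t ≤ 1 := by
    by_contra! hcon
    obtain ⟨t₁, ht₁, hdt₁⟩ := hcon
    have hclosed : IsCompact (Icc 0 T ∩ d ⁻¹' Ici 1) :=
      isCompact_Icc.of_isClosed_subset (hd.preimage_isClosed_of_isClosed isClosed_Icc isClosed_Ici)
        inter_subset_left
    -- At the first time when `d` is at least $1$, the bound `main` still applies, as it needs only
    -- earlier times, and it contradicts `hsmall`.
    obtain ⟨τ, hτ⟩ := hclosed.exists_isLeast ⟨t₁, ht₁, hdt₁.le⟩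
    have h1 := main τ hτ.1.1 fun s hs => by
      by_contra! hs1
      exact absurd (hτ.2 ⟨⟨hs.1, hs.2.le.trans hτ.1.1.2⟩, hs1.le⟩) (not_le.2 hs.2)
    have h2 : 1 ≤ d τ := hτ.1.2
    linarith
  exact fun t ht => main t ht fun s hs => hbelow s ⟨hs.1, hs.2.le.trans ht.2⟩

/-! ### Growth and local Lipschitz bounds of the Riccati nonlinearity -/

theorem exists_norm_riccatiR_le (ρ η lam : ℝ) (w : ℂ) :
    ∃ C : ℝ, 0 ≤ C ∧ ∀ z, ‖riccatiR ρ η lam w z‖ ≤ C * (1 + ‖z‖ ^ 2) := by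
  refine ⟨‖(w ^ 2 - w) / 2‖ + ‖(ρ : ℂ) * η * w - lam‖ + ‖(η : ℂ) ^ 2 / 2‖, by positivity,
    fun z => ?_⟩
  have h1 : ‖riccatiR ρ η lam w z‖ ≤ ‖(w ^ 2 - w) / 2‖
      + (‖(ρ : ℂ) * η * w - lam‖ + ‖(η : ℂ) ^ 2 / 2‖ * ‖z‖) * ‖z‖ := by
    unfold riccatiR
    refine (norm_add_le _ _).trans ?_
    rw [norm_mul, ← norm_mul]
    gcongr
    rw [norm_mul]
    gcongr
    exact (norm_add_le _ _).trans_eq (by rw [norm_mul])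
  have h2 : ‖z‖ ≤ 1 + ‖z‖ ^ 2 := by nlinarith [sq_nonneg (‖z‖ - 1), norm_nonneg z]
  have h3 : 0 ≤ ‖z‖ ^ 2 := by positivity
  have a1 := norm_nonneg ((w ^ 2 - w) / 2)
  have a2 := norm_nonneg ((ρ : ℂ) * η * w - lam)
  have a3 := norm_nonneg ((η : ℂ) ^ 2 / 2)
  nlinarith [mul_nonneg a1 h3, mul_le_mul_of_nonneg_left h2 a2]

/-- A difference of quadratic polynomials factors through $z-y$, with cofactor affine in
$z+y=(z-y)+2y$. Only `y` needs an a priori bound, so the constant depends on the limit solution and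
not on `n`. -/
theorem exists_norm_riccatiR_sub_le (ρ η lam : ℝ) (w : ℂ) (B : ℝ) :
    ∃ C : ℝ, 0 ≤ C ∧ ∀ y z, ‖y‖ ≤ B → ‖z - y‖ ≤ 1 →
      ‖riccatiR ρ η lam w z - riccatiR ρ η lam w y‖ ≤ C * ‖z - y‖ := by
  refine ⟨‖(ρ : ℂ) * η * w - lam‖ + ‖(η : ℂ) ^ 2 / 2‖ * (2 * |B| + 1), by positivity,
    fun y z hy hz => ?_⟩
  have e : riccatiR ρ η lam w z - riccatiR ρ η lam w y
      = ((ρ : ℂ) * η * w - lam + (η : ℂ) ^ 2 / 2 * ((z - y) + 2 * y)) * (z - y) := by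
    unfold riccatiR; ring
  rw [e, norm_mul]
  gcongr
  refine (norm_add_le _ _).trans ?_
  rw [norm_mul]
  gcongr
  refine (norm_add_le _ _).trans ?_
  rw [norm_mul, Complex.norm_ofNat]
  linarith [le_abs_self B]

theorem continuous_riccatiR (ρ η lam : ℝ) (w : ℂ) : Continuous (riccatiR ρ η lam w) := by
  unfold riccatiR; fun_prop

/-! ### One-variable profiles and truncated kernels -/

/-- A solution `Ψ` of the Riccati equation is `Ψ(t, ξ) = φ(t - ξ)` for this function `φ`. -/
noncomputable def profile (ρ η lam : ℝ) (w : ℂ) (h ψ : ℝ → ℂ) (s : ℝ) : ℂ :=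
  if 0 < s then riccatiR ρ η lam w (ψ s) else h (-s)

theorem profile_of_pos {ρ η lam : ℝ} {w : ℂ} {h ψ : ℝ → ℂ} {s : ℝ} (hs : 0 < s) :
    profile ρ η lam w h ψ s = riccatiR ρ η lam w (ψ s) := if_pos hs

theorem profile_of_nonpos {ρ η lam : ℝ} {w : ℂ} {h ψ : ℝ → ℂ} {s : ℝ} (hs : s ≤ 0) :
    profile ρ η lam w h ψ s = h (-s) := if_neg hs.not_gt

theorem eq_zero_of_suppPos_subset {f : ℝ → ℂ} {M x : ℝ} (hf : suppPos f ⊆ Icc 0 M) (hx : 0 ≤ x)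
    (hMx : M < x) : f x = 0 := by
  by_contra h0
  exact absurd (hf (subset_closure ⟨hx, h0⟩)).2 (not_le.2 hMx)

theorem profile_eq_zero {ρ η lam : ℝ} {w : ℂ} {h ψ : ℝ → ℂ} {M s : ℝ} (hM : 0 ≤ M)
    (hsupp : suppPos h ⊆ Icc 0 M) (hs : s < -M) : profile ρ η lam w h ψ s = 0 := by
  rw [profile_of_nonpos (by linarith)]
  exact eq_zero_of_suppPos_subset hsupp (by linarith) (by linarith)

/-- The kernel `K` restricted to `(0, S]`. -/
noncomputable def truncKernel (K : ℝ → ℝ) (S : ℝ) : ℝ → ℝ := (Ioc 0 S).indicator K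

theorem truncKernel_of_nonpos {K : ℝ → ℝ} {S x : ℝ} (hx : x ≤ 0) : truncKernel K S x = 0 :=
  indicator_of_notMem (fun h => absurd h.1 hx.not_gt) _

theorem MemL2loc.memLp_truncKernel {K : ℝ → ℝ} (hK : MemL2loc K) (S : ℝ) :
    MemLp (truncKernel K S) 2 := by
  rw [truncKernel, memLp_indicator_iff_restrict measurableSet_Ioc]
  exact (hK S).mono_measure (Measure.restrict_mono Ioc_subset_Icc_self le_rfl)

theorem MemL2loc.integrable_truncKernel {K : ℝ → ℝ} (hK : MemL2loc K) (S : ℝ) :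
    Integrable (truncKernel K S) := by
  rw [truncKernel, integrable_indicator_iff measurableSet_Ioc]
  exact IntegrableOn.mono_set ((hK S).integrable (by norm_num)) Ioc_subset_Icc_self

/-- Hölder's inequality on an interval of finite length: $L^2$ convergence implies $L^1$
convergence. -/
theorem tendsto_integral_norm_truncKernel_sub {K : ℝ → ℝ} {Kn : ℕ → ℝ → ℝ} (hK : MemL2loc K)
    (hKn : ∀ n, MemL2loc (Kn n)) {S : ℝ}
    (hconv : Tendsto (fun n => eLpNorm (Kn n - K) 2 (volume.restrict (Icc 0 S))) atTop (𝓝 0)) :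
    Tendsto (fun n => ∫ x, ‖truncKernel (Kn n) S x - truncKernel K S x‖) atTop (𝓝 0) := by
  have e : ∀ n, ∫ x, ‖truncKernel (Kn n) S x - truncKernel K S x‖
      ≤ (eLpNorm (Kn n - K) 2 (volume.restrict (Icc 0 S))
          * (volume.restrict (Icc 0 S)) univ ^ (1 / (1 : ℝ) - 1 / 2)).toReal := by
    intro n
    have hmem := (hKn n S).sub (hK S)
    have hd : Integrable fun x => truncKernel (Kn n) S x - truncKernel K S x :=
      ((hKn n).integrable_truncKernel S).sub (hK.integrable_truncKernel S)
    rw [integral_norm_eq_lintegral_enorm hd.aestronglyMeasurable]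
    refine ENNReal.toReal_mono (ENNReal.mul_ne_top hmem.2.ne
      (ENNReal.rpow_ne_top_of_nonneg (by norm_num) (by simp))) ?_
    have h1 := eLpNorm_le_eLpNorm_mul_rpow_measure_univ (p := 1) (q := 2) (by norm_num) hmem.1
    rw [eLpNorm_one_eq_lintegral_enorm] at h1
    simp only [ENNReal.toReal_one, ENNReal.toReal_ofNat] at h1
    refine le_trans ?_ h1
    rw [← lintegral_indicator measurableSet_Icc]
    refine lintegral_mono fun x => ?_
    by_cases hx : x ∈ Ioc 0 S
    · simp [truncKernel, hx, Ioc_subset_Icc_self hx]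
    · simp [truncKernel, hx]
  refine squeeze_zero (fun n => integral_nonneg fun x => norm_nonneg _) e ?_
  have := ENNReal.Tendsto.mul_const (b := (volume.restrict (Icc 0 S)) univ ^ (1 / (1 : ℝ) - 1 / 2))
    hconv (Or.inr (ENNReal.rpow_ne_top_of_nonneg (by norm_num) (by simp)))
  rw [zero_mul] at this
  exact (ENNReal.tendsto_toReal ENNReal.zero_ne_top).comp this

theorem IsAdmissibleKernel.kernelMonotone {γ : ℝ} {c K : ℝ → ℝ} (hK : IsAdmissibleKernel γ c K) :
    KernelMonotone K := by
  have := hK.monotone 0 le_rfl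
  rwa [show shift 0 K = K from funext fun t => by simp [shift]] at this

/-! ### Integrability, boundedness and continuity for one solution -/

section Solution

variable {ρ η lam : ℝ} {w : ℂ} {K : ℝ → ℝ} {h : ℝ → ℂ} {Ψ : ℝ → ℝ → ℂ} {M T : ℝ}

theorem IsRiccatiSolution.eq_profile (hΨ : IsRiccatiSolution ρ η lam w K h Ψ) {t ξ : ℝ}
    (ht : 0 ≤ t) (hξ : 0 ≤ ξ) : Ψ t ξ = profile ρ η lam w h (psi K Ψ) (t - ξ) := by
  rw [hΨ.eq t ξ ht hξ, profile]
  simp only [sub_pos, neg_sub]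

/-- The profile of a solution restricted to `[-M, T]`. -/
noncomputable def truncProfile (ρ η lam : ℝ) (w : ℂ) (h ψ : ℝ → ℂ) (M T : ℝ) : ℝ → ℂ :=
  (Icc (-M) T).indicator (profile ρ η lam w h ψ)

theorem truncProfile_eq {ψ : ℝ → ℂ} (hM : 0 ≤ M) (hsupp : suppPos h ⊆ Icc 0 M) {s : ℝ}
    (hs : s ≤ T) : truncProfile ρ η lam w h ψ M T s = profile ρ η lam w h ψ s := by
  by_cases hs' : -M ≤ s
  · exact indicator_of_mem (show s ∈ Icc (-M) T from ⟨hs', hs⟩) _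
  · rw [profile_eq_zero hM hsupp (not_le.1 hs')]
    exact indicator_of_notMem (fun h => hs' h.1) _

/-- Both truncations are harmless: for $x>0$ one has $t-x\le T$, and for $x>M+T$ the argument $t-x$
lies below $-M$, where the profile vanishes. -/
theorem IsRiccatiSolution.indicator_mul_eq (hΨ : IsRiccatiSolution ρ η lam w K h Ψ) (hM : 0 ≤ M)
    (hsupp : suppPos h ⊆ Icc 0 M) {t : ℝ} (ht : t ∈ Icc 0 T) :
    (Ioi (0 : ℝ)).indicator (fun ξ => Ψ t ξ * (K ξ : ℂ)) = fun x =>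
      truncProfile ρ η lam w h (psi K Ψ) M T (t - x) * (truncKernel K (M + T) x : ℂ) := by
  funext x
  rcases le_or_gt x 0 with hx | hx
  · rw [truncKernel_of_nonpos hx, indicator_of_notMem (notMem_Ioi.2 hx)]
    simp
  · rw [indicator_of_mem (mem_Ioi.2 hx), truncProfile_eq hM hsupp (by linarith [ht.2]),
      hΨ.eq_profile ht.1 hx.le]
    by_cases hxS : x ≤ M + T
    · rw [truncKernel, indicator_of_mem (show x ∈ Ioc 0 (M + T) from ⟨hx, hxS⟩)]
    · rw [profile_eq_zero hM hsupp (by linarith [ht.2, not_le.1 hxS])]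
      simp

theorem IsRiccatiSolution.psi_eq (hΨ : IsRiccatiSolution ρ η lam w K h Ψ) (hM : 0 ≤ M)
    (hsupp : suppPos h ⊆ Icc 0 M) {t : ℝ} (ht : t ∈ Icc 0 T) :
    psi K Ψ t = ∫ x, truncProfile ρ η lam w h (psi K Ψ) M T (t - x)
      * (truncKernel K (M + T) x : ℂ) := by
  rw [← hΨ.indicator_mul_eq hM hsupp ht, integral_indicator measurableSet_Ioi]
  rfl

/-- On $(0,\delta]$ the kernel is at least $K(\delta)>0$, so dividing the integrable function
$\Psi(t,\cdot)K$ by $K$ gives integrability of the profile on $[t-\delta,t)$. Finitely many such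
intervals, together with the initial part given by `h`, cover $[-M,T]$. -/
theorem IsRiccatiSolution.integrable_truncProfile (hΨ : IsRiccatiSolution ρ η lam w K h Ψ)
    (hKm : KernelMonotone K) (hh : MemBc h) :
    Integrable (truncProfile ρ η lam w h (psi K Ψ) M T) := by
  set φ := profile ρ η lam w h (psi K Ψ) with hφ
  obtain ⟨δ, hδ, hKδ0⟩ := hKm.nonzero
  have hKδ : 0 < K δ := lt_of_le_of_ne (hKm.nonneg δ hδ) (Ne.symm hKδ0)
  have hKx : ∀ x ∈ Ioc 0 δ, K δ ≤ K x := fun x hx => hKm.antitone hx.1 hδ hx.2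
  have hstep : ∀ t, 0 ≤ t → IntegrableOn φ (Ico (t - δ) t) := by
    intro t ht
    have h1 : IntegrableOn (fun x => φ (t - x)) (Ioc 0 δ) := by
      have h2 : IntegrableOn (fun x => ((K x)⁻¹ : ℝ) • (Ψ t x * (K x : ℂ))) (Ioc 0 δ) := by
        refine Integrable.bdd_smul (φ := fun x => (K x)⁻¹)
          (IntegrableOn.mono_set (hΨ.integrable t ht) Ioc_subset_Ioi_self) (K δ)⁻¹ ?_ ?_
        · refine ContinuousOn.aestronglyMeasurable ?_ measurableSet_Ioc
          exact (hKm.continuous.mono Ioc_subset_Ioi_self).inv₀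
            fun x hx => (hKδ.trans_le (hKx x hx)).ne'
        · refine (ae_restrict_iff' measurableSet_Ioc).2 (ae_of_all _ fun x hx => ?_)
          have hpos := hKδ.trans_le (hKx x hx)
          rw [Real.norm_of_nonneg (inv_nonneg.2 hpos.le)]
          exact inv_anti₀ hKδ (hKx x hx)
      refine h2.congr_fun (fun x hx => ?_) measurableSet_Ioc
      have hne : (K x : ℂ) ≠ 0 := by exact_mod_cast (hKδ.trans_le (hKx x hx)).ne'
      dsimp only
      rw [hΨ.eq_profile ht hx.1.le, Complex.real_smul, Complex.ofReal_inv, mul_comm,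
        mul_inv_cancel_right₀ hne]
    have h3 := (Measure.measurePreserving_sub_left volume t).integrableOn_comp_preimage
      (MeasurableEquiv.subLeft t).measurableEmbedding (f := φ) (s := Ico (t - δ) t)
    refine h3.1 ?_
    have : (fun x => t - x) ⁻¹' Ico (t - δ) t = Ioc 0 δ := by
      ext x; simp only [mem_preimage, mem_Ico, mem_Ioc]
      constructor <;> rintro ⟨h1, h2⟩ <;> constructor <;> linarith
    rw [this]
    exact h1
  have hinit : IntegrableOn φ (Ico (-M) 0) := by
    obtain ⟨C, hC⟩ := hh.1.2
    have h1 : IntegrableOn h (Ioc 0 M) := by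
      refine Integrable.of_bound (C := C)
        (hh.1.1.mono_measure (Measure.restrict_mono
          (Ioc_subset_Icc_self.trans Icc_subset_Ici_self) le_rfl)) ?_
      exact (ae_restrict_iff' measurableSet_Ioc).2 (ae_of_all _ fun x hx => hC x hx.1.le)
    have h3 := (Measure.measurePreserving_neg volume).integrableOn_comp_preimage
      (MeasurableEquiv.neg ℝ).measurableEmbedding (f := h) (s := Ioc 0 M)
    have h4 := h3.2 h1
    have : Neg.neg ⁻¹' Ioc 0 M = Ico (-M) 0 := by simp
    rw [this] at h4
    exact h4.congr_fun (fun x hx => (profile_of_nonpos hx.2.le).symm) measurableSet_Ico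
  have hind : ∀ n : ℕ, IntegrableOn φ (Ico (-M) (n * δ)) := by
    intro n
    induction n with
    | zero => simpa using hinit
    | succ n ih =>
      refine (ih.union (hstep ((n + 1 : ℕ) * δ) (by positivity))).mono_set fun x hx => ?_
      rcases lt_or_ge x (n * δ) with h1 | h1
      · exact Or.inl ⟨hx.1, h1⟩
      · refine Or.inr ⟨?_, hx.2⟩
        push_cast
        linarith
  obtain ⟨n, hn⟩ := exists_nat_gt (T / δ)
  rw [truncProfile, integrable_indicator_iff measurableSet_Icc]
  exact (hind n).mono_set fun x hx => ⟨hx.1, hx.2.trans_lt ((div_lt_iff₀ hδ).1 hn)⟩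

/-- Quadratic growth of $\mathcal R$ and Cauchy–Schwarz yield $|\varphi|\le a+b\,(|\varphi|*k^2)$
with $b=C\|\varphi\|_1<\infty$. Since $k\in L^2$, the kernel $k^2$ is integrable and the convolution
Gronwall inequality applies. -/
theorem IsRiccatiSolution.ae_norm_truncProfile_le (hΨ : IsRiccatiSolution ρ η lam w K h Ψ)
    (hK2 : MemL2loc K) (hKm : KernelMonotone K) (hh : MemBc h) (hM : 0 ≤ M)
    (hsupp : suppPos h ⊆ Icc 0 M) :
    ∃ B : ℝ, ∀ᵐ s, ‖truncProfile ρ η lam w h (psi K Ψ) M T s‖ ≤ B := by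
  set φ := truncProfile ρ η lam w h (psi K Ψ) M T with hφ
  have hφint : Integrable φ := hΨ.integrable_truncProfile hKm hh
  obtain ⟨H, hH⟩ := hh.1.2
  obtain ⟨C, hC0, hC⟩ := exists_norm_riccatiR_le ρ η lam w
  set k := truncKernel K (M + T) with hk
  have hkm : AEMeasurable (fun x => ‖k x‖ₑ) :=
    (hK2.integrable_truncKernel _).aestronglyMeasurable.enorm
  have hφm : AEMeasurable (fun x => ‖φ x‖ₑ) := hφint.aestronglyMeasurable.enorm
  have hksq : ∫⁻ x, ‖k x‖ₑ ^ 2 ≠ ∞ := by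
    have := (hK2.memLp_truncKernel (M + T)).eLpNorm_lt_top
    rw [eLpNorm_lt_top_iff_lintegral_rpow_enorm_lt_top (by norm_num) (by norm_num)] at this
    simpa using this.ne
  obtain ⟨B, hB, hle⟩ := exists_ae_le_of_le_add_mul_lintegral (f := fun x => ‖φ x‖ₑ)
    (k := fun x => ‖k x‖ₑ ^ 2) (M := M) (T := T) (a := ENNReal.ofReal C + ENNReal.ofReal H)
    (b := ENNReal.ofReal C * ∫⁻ x, ‖φ x‖ₑ) hφm (hkm.pow_const 2) hφint.2.ne hksq
    (fun x hx => by simp [hk, truncKernel_of_nonpos hx])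
    (fun s hs => by simp [hφ, truncProfile, hs]) (by finiteness)
    (ENNReal.mul_ne_top ENNReal.ofReal_ne_top hφint.2.ne) (by
      intro t ht
      have et : φ t = profile ρ η lam w h (psi K Ψ) t := truncProfile_eq hM hsupp ht.2
      rcases le_or_gt t 0 with h0 | h0
      · rw [et, profile_of_nonpos h0]
        calc ‖h (-t)‖ₑ ≤ ENNReal.ofReal H := by
              rw [← ofReal_norm]
              exact ENNReal.ofReal_le_ofReal (hH _ (by simpa using h0))
          _ ≤ _ := le_add_right le_add_self
      · have h1 : ‖psi K Ψ t‖ₑ ≤ ∫⁻ x, ‖φ (t - x)‖ₑ * ‖k x‖ₑ := by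
          rw [hΨ.psi_eq hM hsupp ⟨h0.le, ht.2⟩]
          refine (enorm_integral_le_lintegral_enorm _).trans_eq (lintegral_congr fun x => ?_)
          rw [enorm_mul]
          congr 1
          rw [← ofReal_norm, ← ofReal_norm, Complex.norm_real]
        have h2 : ‖psi K Ψ t‖ₑ ^ 2 ≤ (∫⁻ x, ‖φ x‖ₑ) * ∫⁻ x, ‖φ (t - x)‖ₑ * ‖k x‖ₑ ^ 2 := by
          refine (pow_le_pow_left' h1 2).trans
            ((lintegral_mul_sq_le (aemeasurable_comp_sub_left hφm t) hkm).trans_eq ?_)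
          rw [lintegral_sub_left_eq_self (fun x => ‖φ x‖ₑ) t]
        rw [et, profile_of_pos h0]
        calc ‖riccatiR ρ η lam w (psi K Ψ t)‖ₑ
            ≤ ENNReal.ofReal C * (1 + ‖psi K Ψ t‖ₑ ^ 2) := by
              rw [← ofReal_norm, ← ofReal_norm,
                ← ENNReal.ofReal_pow (norm_nonneg _), ← ENNReal.ofReal_one,
                ← ENNReal.ofReal_add zero_le_one (by positivity), ← ENNReal.ofReal_mul hC0]
              exact ENNReal.ofReal_le_ofReal (hC _)
          _ ≤ ENNReal.ofReal C * (1 + (∫⁻ x, ‖φ x‖ₑ) * ∫⁻ x, ‖φ (t - x)‖ₑ * ‖k x‖ₑ ^ 2) := by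
              gcongr
          _ = ENNReal.ofReal C + ENNReal.ofReal C * (∫⁻ x, ‖φ x‖ₑ)
                * ∫⁻ x, ‖φ (t - x)‖ₑ * ‖k x‖ₑ ^ 2 := by ring
          _ ≤ _ := by gcongr; exact le_self_add)
  refine ⟨B.toReal, hle.mono fun s hs => ?_⟩
  rw [← toReal_enorm]
  exact ENNReal.toReal_mono hB hs

theorem IsRiccatiSolution.continuousOn_psi (hΨ : IsRiccatiSolution ρ η lam w K h Ψ)
    (hK2 : MemL2loc K) (hKm : KernelMonotone K) (hh : MemBc h) (hM : 0 ≤ M)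
    (hsupp : suppPos h ⊆ Icc 0 M) : ContinuousOn (psi K Ψ) (Icc 0 T) := by
  obtain ⟨B, hB⟩ := hΨ.ae_norm_truncProfile_le (T := T) hK2 hKm hh hM hsupp
  exact (continuous_integral_comp_sub_mul (hΨ.integrable_truncProfile hKm hh) hB
    (hK2.integrable_truncKernel (M + T)).ofReal).continuousOn.congr
      fun t ht => hΨ.psi_eq hM hsupp ht

/-- Once $\psi$ is known to be continuous, compactness upgrades the almost everywhere bound to one
valid at every point. -/
theorem exists_norm_truncProfile_le {ψ : ℝ → ℂ} (hψ : ContinuousOn ψ (Icc 0 T)) (hh : MemBc h) :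
    ∃ B : ℝ, 0 ≤ B ∧ ∀ s, ‖truncProfile ρ η lam w h ψ M T s‖ ≤ B := by
  obtain ⟨H, hH⟩ := hh.1.2
  obtain ⟨C, hC⟩ := isCompact_Icc.exists_bound_of_continuousOn
    ((continuous_riccatiR ρ η lam w).comp_continuousOn hψ)
  refine ⟨max (max H C) 0, le_max_right _ _, fun s => ?_⟩
  by_cases hs : s ∈ Icc (-M) T
  · rw [truncProfile, indicator_of_mem hs]
    refine le_trans ?_ (le_max_left _ _)
    rcases le_or_gt s 0 with h0 | h0
    · rw [profile_of_nonpos h0]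
      exact (hH _ (by simpa using h0)).trans (le_max_left _ _)
    · rw [profile_of_pos h0]
      exact (hC s ⟨h0.le, hs.2⟩).trans (le_max_right _ _)
  · rw [truncProfile, indicator_of_notMem hs, norm_zero]
    exact le_max_right _ _

theorem IsRiccatiSolution.suppPos_subset (hΨ : IsRiccatiSolution ρ η lam w K h Ψ) (hM : 0 ≤ M)
    (hsupp : suppPos h ⊆ Icc 0 M) {t : ℝ} (ht : t ∈ Icc 0 T) :
    suppPos (Ψ t) ⊆ Icc 0 (M + T) := by
  refine closure_minimal (fun x hx => ⟨hx.1, ?_⟩) isClosed_Icc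
  by_contra! hlt
  refine hx.2 ?_
  rw [hΨ.eq_profile ht.1 hx.1]
  exact profile_eq_zero hM hsupp (by linarith [ht.2])

theorem IsRiccatiSolution.memB (hΨ : IsRiccatiSolution ρ η lam w K h Ψ)
    (hK2 : MemL2loc K) (hKm : KernelMonotone K) (hh : MemBc h) (hM : 0 ≤ M)
    (hsupp : suppPos h ⊆ Icc 0 M) {t : ℝ} (ht : t ∈ Icc 0 T) :
    MemB (Icc 0 (M + T)) (Ψ t) := by
  obtain ⟨B, -, hB⟩ := exists_norm_truncProfile_le (ρ := ρ) (η := η) (lam := lam) (w := w) (M := M)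
    (hΨ.continuousOn_psi (T := T) hK2 hKm hh hM hsupp) hh
  have e : EqOn (fun x => truncProfile ρ η lam w h (psi K Ψ) M T (t - x)) (Ψ t)
      (Icc 0 (M + T)) := fun x hx => by
    dsimp only
    rw [hΨ.eq_profile ht.1 hx.1, truncProfile_eq hM hsupp (by linarith [ht.2, hx.1])]
  refine ⟨?_, B, fun x hx => ?_⟩
  · have h1 : AEStronglyMeasurable fun x => truncProfile ρ η lam w h (psi K Ψ) M T (t - x) :=
      (hΨ.integrable_truncProfile hKm hh).aestronglyMeasurable.comp_quasiMeasurePreserving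
        (Measure.measurePreserving_sub_left volume t).quasiMeasurePreserving
    exact h1.restrict.congr
      ((ae_restrict_iff' measurableSet_Icc).2 (ae_of_all _ fun x hx => e hx))
  · rw [← e hx]
    exact hB _

end Solution

/-! ### Stability and uniform convergence -/

/-- Stability of a convolution, for a perturbation of the function that satisfies an exponentially
weighted bound. -/
theorem norm_integral_comp_sub_mul_sub_le {φ φ' : ℝ → ℂ} {k k' : ℝ → ℝ} {t l B σ D q : ℝ}
    (hφ : Integrable φ) (hφ' : Integrable φ') (hB : ∀ s, ‖φ s‖ ≤ B) {B' : ℝ}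
    (hB' : ∀ s, ‖φ' s‖ ≤ B') (hk : Integrable k) (hk' : Integrable k')
    (hk0 : ∀ x ≤ 0, k x = 0) (hk0' : ∀ x ≤ 0, k' x = 0) (hl : 0 ≤ l)
    (hσ : 0 ≤ σ) (hD : 0 ≤ D) (hq0 : 0 ≤ q)
    (hq : ∫⁻ x, expWeight l x * ‖k x‖ₑ ≤ ENNReal.ofReal q)
    (hle : ∀ s < t, ‖φ' s - φ s‖ ≤ σ + D * Real.exp (l * s)) :
    ‖(∫ x, φ' (t - x) * (k' x : ℂ)) - ∫ x, φ (t - x) * (k x : ℂ)‖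
      ≤ σ * ((∫ x, ‖k x‖) + ∫ x, ‖k' x - k x‖)
        + D * Real.exp (l * t) * (q + ∫ x, ‖k' x - k x‖) + B * ∫ x, ‖k' x - k x‖ := by
  have hmeas : ∀ {f : ℝ → ℂ}, Integrable f → AEStronglyMeasurable fun x => f (t - x) := fun hf =>
    hf.aestronglyMeasurable.comp_quasiMeasurePreserving
      (Measure.measurePreserving_sub_left volume t).quasiMeasurePreserving
  have hint : Integrable fun x => φ (t - x) * (k x : ℂ) :=
    hk.ofReal.bdd_mul (hmeas hφ) (ae_of_all _ fun x => hB _)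
  have hint' : Integrable fun x => φ' (t - x) * (k' x : ℂ) :=
    hk'.ofReal.bdd_mul (hmeas hφ') (ae_of_all _ fun x => hB' _)
  have hsub : Integrable fun x => ‖k' x - k x‖ := (hk'.sub hk).norm
  have hqint : Integrable fun x => Real.exp (-(l * x)) * ‖k x‖ := by
    refine ⟨(by fun_prop : Continuous fun x : ℝ => Real.exp (-(l * x))).aestronglyMeasurable.mul
      hk.aestronglyMeasurable.norm, ?_⟩
    refine lt_of_le_of_lt (le_trans (le_of_eq (lintegral_congr fun x => ?_)) hq)
      ENNReal.ofReal_lt_top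
    rw [enorm_mul, enorm_norm, expWeight, Real.enorm_of_nonneg (Real.exp_pos _).le]
  have hqle : ∫ x, Real.exp (-(l * x)) * ‖k x‖ ≤ q := by
    rw [integral_eq_lintegral_of_nonneg_ae (ae_of_all _ fun x => by positivity)
      hqint.aestronglyMeasurable]
    refine ENNReal.toReal_le_of_le_ofReal hq0 (le_trans (le_of_eq (lintegral_congr fun x => ?_)) hq)
    rw [ENNReal.ofReal_mul (Real.exp_pos _).le, ofReal_norm, expWeight]
  have i1 : Integrable fun x => σ * (‖k x‖ + ‖k' x - k x‖) := (hk.norm.add hsub).const_mul σ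
  have i2 : Integrable fun x =>
      D * Real.exp (l * t) * (Real.exp (-(l * x)) * ‖k x‖ + ‖k' x - k x‖) :=
    (hqint.add hsub).const_mul _
  have i12 : Integrable fun x => σ * (‖k x‖ + ‖k' x - k x‖)
      + D * Real.exp (l * t) * (Real.exp (-(l * x)) * ‖k x‖ + ‖k' x - k x‖) := i1.add i2
  have hI : Integrable fun x => σ * (‖k x‖ + ‖k' x - k x‖)
      + D * Real.exp (l * t) * (Real.exp (-(l * x)) * ‖k x‖ + ‖k' x - k x‖)
      + B * ‖k' x - k x‖ :=
    i12.add (hsub.const_mul B)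
  rw [← integral_sub hint' hint]
  calc ‖∫ x, (φ' (t - x) * (k' x : ℂ) - φ (t - x) * (k x : ℂ))‖
      ≤ ∫ x, (σ * (‖k x‖ + ‖k' x - k x‖)
        + D * Real.exp (l * t) * (Real.exp (-(l * x)) * ‖k x‖ + ‖k' x - k x‖)
        + B * ‖k' x - k x‖) := by
        refine norm_integral_le_of_norm_le hI (ae_of_all _ fun x => ?_)
        rcases le_or_gt x 0 with hx | hx
        · simp [hk0 x hx, hk0' x hx]
        -- The cross term carries `k'`, which is then bounded by $|k|+|k'-k|$: only the weighted
        -- mass of the fixed kernel `k` has to be small, so `l` can be chosen independently of `k'`.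
        have e1 : φ' (t - x) * (k' x : ℂ) - φ (t - x) * (k x : ℂ)
            = (φ' (t - x) - φ (t - x)) * (k' x : ℂ) + φ (t - x) * ((k' x - k x : ℝ) : ℂ) := by
          push_cast; ring
        have e2 : Real.exp (l * (t - x)) = Real.exp (l * t) * Real.exp (-(l * x)) := by
          rw [← Real.exp_add]; ring_nf
        have h1 : ‖k' x‖ ≤ ‖k x‖ + ‖k' x - k x‖ := by
          simpa using norm_add_le (k x) (k' x - k x)
        have h2 : Real.exp (-(l * x)) * ‖k' x‖ ≤ Real.exp (-(l * x)) * ‖k x‖ + ‖k' x - k x‖ := by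
          have h3 : Real.exp (-(l * x)) ≤ 1 := Real.exp_le_one_iff.2 (by simpa using by positivity)
          calc Real.exp (-(l * x)) * ‖k' x‖
              ≤ Real.exp (-(l * x)) * (‖k x‖ + ‖k' x - k x‖) := by gcongr
            _ ≤ Real.exp (-(l * x)) * ‖k x‖ + 1 * ‖k' x - k x‖ := by
              rw [mul_add]; gcongr
            _ = _ := by rw [one_mul]
        calc ‖φ' (t - x) * (k' x : ℂ) - φ (t - x) * (k x : ℂ)‖
            ≤ ‖φ' (t - x) - φ (t - x)‖ * ‖k' x‖ + ‖φ (t - x)‖ * ‖k' x - k x‖ := by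
              rw [e1]
              refine (norm_add_le _ _).trans_eq ?_
              rw [norm_mul, norm_mul, Complex.norm_real, Complex.norm_real]
          _ ≤ (σ + D * Real.exp (l * (t - x))) * ‖k' x‖ + B * ‖k' x - k x‖ := by
              gcongr
              · exact hle _ (by linarith)
              · exact hB _
          _ = σ * ‖k' x‖ + D * Real.exp (l * t) * (Real.exp (-(l * x)) * ‖k' x‖)
              + B * ‖k' x - k x‖ := by rw [e2]; ring
          _ ≤ _ := by gcongr
    _ = σ * ((∫ x, ‖k x‖) + ∫ x, ‖k' x - k x‖)
        + D * Real.exp (l * t) * ((∫ x, Real.exp (-(l * x)) * ‖k x‖) + ∫ x, ‖k' x - k x‖)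
        + B * ∫ x, ‖k' x - k x‖ := by
        rw [integral_add i12 (hsub.const_mul B), integral_add i1 i2, integral_const_mul,
          integral_const_mul, integral_const_mul, integral_add hk.norm hsub,
          integral_add hqint hsub]
    _ ≤ _ := by gcongr

theorem norm_profile_sub_le {ρ η lam : ℝ} {w : ℂ} {h h' ψ ψ' : ℝ → ℂ} {M σ e s : ℝ} (hM : 0 ≤ M)
    (hsupp : suppPos h ⊆ Icc 0 M) (hsupp' : suppPos h' ⊆ Icc 0 M) (hσ : 0 ≤ σ)
    (hh : ∀ x ∈ Icc 0 M, ‖h' x - h x‖ ≤ σ) (he : 0 ≤ e)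
    (hR : 0 < s → ‖riccatiR ρ η lam w (ψ' s) - riccatiR ρ η lam w (ψ s)‖ ≤ e) :
    ‖profile ρ η lam w h' ψ' s - profile ρ η lam w h ψ s‖ ≤ σ + e := by
  rcases lt_or_ge 0 s with h0 | h0
  · rw [profile_of_pos h0, profile_of_pos h0]
    linarith [hR h0]
  rcases lt_or_ge s (-M) with h1 | h1
  · rw [profile_eq_zero hM hsupp h1, profile_eq_zero hM hsupp' h1, sub_self, norm_zero]
    positivity
  · rw [profile_of_nonpos h0, profile_of_nonpos h0]
    linarith [hh (-s) ⟨by linarith, by linarith⟩]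

theorem tendstoUniformlyOn_psi {ρ η lam : ℝ} {w : ℂ} {K : ℝ → ℝ} {Kn : ℕ → ℝ → ℝ} {h : ℝ → ℂ}
    {hn : ℕ → ℝ → ℂ} {Ψ : ℝ → ℝ → ℂ} {Ψn : ℕ → ℝ → ℝ → ℂ} {M T : ℝ}
    (hK2 : MemL2loc K) (hKm : KernelMonotone K) (hKn2 : ∀ n, MemL2loc (Kn n))
    (hKnm : ∀ n, KernelMonotone (Kn n))
    (hKconv : Tendsto (fun n => eLpNorm (Kn n - K) 2 (volume.restrict (Icc 0 (M + T)))) atTop (𝓝 0))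
    (hh : MemBc h) (hhn : ∀ n, MemBc (hn n)) (hM : 0 ≤ M)
    (hsupp : suppPos h ⊆ Icc 0 M) (hsuppn : ∀ n, suppPos (hn n) ⊆ Icc 0 M)
    (hhconv : TendstoUniformlyOn hn h atTop (Icc 0 M))
    (hΨ : IsRiccatiSolution ρ η lam w K h Ψ)
    (hΨn : ∀ n, IsRiccatiSolution ρ η lam w (Kn n) (hn n) (Ψn n)) :
    TendstoUniformlyOn (fun n => psi (Kn n) (Ψn n)) (psi K Ψ) atTop (Icc 0 T) := by
  have hcont : ContinuousOn (psi K Ψ) (Icc 0 T) := hΨ.continuousOn_psi hK2 hKm hh hM hsupp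
  have hcontn : ∀ n, ContinuousOn (psi (Kn n) (Ψn n)) (Icc 0 T) := fun n =>
    (hΨn n).continuousOn_psi (hKn2 n) (hKnm n) (hhn n) hM (hsuppn n)
  obtain ⟨Bψ, hBψ⟩ := isCompact_Icc.exists_bound_of_continuousOn hcont
  obtain ⟨L, hL0, hL⟩ := exists_norm_riccatiR_sub_le ρ η lam w Bψ
  obtain ⟨B, hB0, hB⟩ := exists_norm_truncProfile_le (ρ := ρ) (η := η) (lam := lam) (w := w)
    (M := M) hcont hh
  set k := truncKernel K (M + T) with hk
  have hkint : Integrable k := hK2.integrable_truncKernel _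
  -- With $Lq\le\frac14$ and a kernel error $\delta\le q$, the feedback factor $L(q+\delta)$ is at
  -- most $\frac12$, as `le_of_weighted_step` requires. The weight `l` depends only on `L` and the
  -- limit kernel.
  set q : ℝ := 1 / (4 * (L + 1)) with hq
  have hq0 : 0 < q := by positivity
  have hLq : L * q ≤ 1 / 4 := by
    rw [hq, mul_one_div, div_le_div_iff₀ (by positivity) (by norm_num)]
    linarith
  obtain ⟨l, hl, hlk⟩ := exists_lintegral_expWeight_mul_le (k := fun x => ‖k x‖ₑ)
    hkint.aestronglyMeasurable.enorm hkint.2.ne (fun x hx => by simp [hk, truncKernel_of_nonpos hx])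
    (ENNReal.ofReal_pos.2 hq0)
  have hδ := tendsto_integral_norm_truncKernel_sub hK2 hKn2 hKconv
  rw [Metric.tendstoUniformlyOn_iff] at hhconv ⊢
  intro e he
  set E := Real.exp (l * T) with hE
  have hEpos : 0 < E := Real.exp_pos _
  -- The final bound $2\varepsilon e^{lT}$ equals $\min(1,e)/2$: below $1$ for the continuity
  -- argument and below `e` for the conclusion.
  set ε : ℝ := min 1 e / (4 * E) with hε
  have hmin : 0 < min 1 e := lt_min one_pos he
  have hε0 : 0 < ε := by positivity
  have hεE : 2 * ε * E = min 1 e / 2 := by rw [hε]; field_simp; norm_num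
  set N := ∫ x, ‖k x‖ with hN
  have hN0 : 0 ≤ N := integral_nonneg fun x => norm_nonneg _
  -- The budget $\varepsilon$ is split evenly: $\sigma(N+\delta)\le\varepsilon/2$ for the initial
  -- conditions and $B\delta\le\varepsilon/2$ for the kernels.
  set σ : ℝ := ε / (2 * (N + 1)) with hσ
  have hσ0 : 0 < σ := by positivity
  have hδ' := (tendsto_order.1 hδ).2 (min 1 (min q (ε / (2 * (B + 1)))))
    (lt_min one_pos (lt_min hq0 (by positivity)))
  filter_upwards [hhconv σ hσ0, hδ'] with n hhσ hδn
  set δ := ∫ x, ‖truncKernel (Kn n) (M + T) x - k x‖ with hδdef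
  have hδ0 : 0 ≤ δ := integral_nonneg fun x => norm_nonneg _
  have hδ1 : δ ≤ 1 := hδn.le.trans (min_le_left _ _)
  have hδq : δ ≤ q := hδn.le.trans ((min_le_right _ _).trans (min_le_left _ _))
  have hδB : δ ≤ ε / (2 * (B + 1)) := hδn.le.trans ((min_le_right _ _).trans (min_le_right _ _))
  have hhσ' : ∀ x ∈ Icc 0 M, ‖hn n x - h x‖ ≤ σ := fun x hx => by
    have := (hhσ x hx).le
    rwa [dist_comm, dist_eq_norm] at this
  -- This bound depends on `n`, but it serves only for integrability and does not enter the
  -- estimate.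
  obtain ⟨B', -, hB'⟩ := exists_norm_truncProfile_le (ρ := ρ) (η := η) (lam := lam) (w := w)
    (M := M) (hcontn n) (hhn n)
  have hstep := le_of_weighted_step (d := fun t => ‖psi (Kn n) (Ψn n) t - psi K Ψ t‖) (T := T)
    (l := l) (ε := ε) ((hcontn n).sub hcont).norm hl hε0.le
    (by rw [hεE]; linarith [min_le_left 1 e]) (by
      intro t ht hle1 D hD hleD
      have hLD : 0 ≤ L * D := by positivity
      have key := norm_integral_comp_sub_mul_sub_le (t := t) (σ := σ) (D := L * D) (q := q)
        (hΨ.integrable_truncProfile (M := M) (T := T) hKm hh)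
        ((hΨn n).integrable_truncProfile (M := M) (T := T) (hKnm n) (hhn n)) hB hB' hkint
        ((hKn2 n).integrable_truncKernel (M + T)) (fun x hx => truncKernel_of_nonpos hx)
        (fun x hx => truncKernel_of_nonpos hx) hl hσ0.le hLD hq0.le hlk (by
          intro s hs
          have hsT : s ≤ T := hs.le.trans ht.2
          rw [truncProfile_eq hM hsupp hsT, truncProfile_eq hM (hsuppn n) hsT]
          refine norm_profile_sub_le hM hsupp (hsuppn n) hσ0.le hhσ' (by positivity) fun hs0 => ?_
          calc _ ≤ L * ‖psi (Kn n) (Ψn n) s - psi K Ψ s‖ :=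
                hL _ _ (hBψ s ⟨hs0.le, hsT⟩) (hle1 s ⟨hs0.le, hs⟩)
            _ ≤ L * (D * Real.exp (l * s)) := by gcongr; exact hleD s ⟨hs0.le, hs⟩
            _ = L * D * Real.exp (l * s) := by ring)
      rw [← (hΨn n).psi_eq hM (hsuppn n) ht, ← hΨ.psi_eq hM hsupp ht] at key
      have hexp1 : 1 ≤ Real.exp (l * t) := Real.one_le_exp (mul_nonneg hl ht.1)
      have b1 : σ * (N + δ) ≤ ε / 2 := by
        calc σ * (N + δ) ≤ σ * (N + 1) := by gcongr
          _ = ε / 2 := by rw [hσ]; field_simp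
      have b2 : B * δ ≤ ε / 2 := by
        calc B * δ ≤ (B + 1) * (ε / (2 * (B + 1))) := by gcongr; linarith
          _ = ε / 2 := by field_simp
      have b3 : L * D * Real.exp (l * t) * (q + δ) ≤ D / 2 * Real.exp (l * t) := by
        calc L * D * Real.exp (l * t) * (q + δ) ≤ L * D * Real.exp (l * t) * (q + q) := by gcongr
          _ = 2 * (L * q) * (D * Real.exp (l * t)) := by ring
          _ ≤ 2 * (1 / 4) * (D * Real.exp (l * t)) := by gcongr
          _ = D / 2 * Real.exp (l * t) := by ring
      have b4 : ε ≤ ε * Real.exp (l * t) := le_mul_of_one_le_right hε0.le hexp1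
      calc ‖psi (Kn n) (Ψn n) t - psi K Ψ t‖
          ≤ σ * (N + δ) + L * D * Real.exp (l * t) * (q + δ) + B * δ := key
        _ ≤ (ε + D / 2) * Real.exp (l * t) := by linarith)
  intro t ht
  rw [dist_comm, dist_eq_norm]
  have := hstep t ht
  rw [hεE] at this
  linarith [min_le_right 1 e]

/-- Uniform convergence of `ψⁿ` and `hⁿ` gives uniform convergence of the solutions `Ψⁿ`. -/
theorem tendstoUniformlyOn_solution {ρ η lam : ℝ} {w : ℂ} {K : ℝ → ℝ} {Kn : ℕ → ℝ → ℝ} {h : ℝ → ℂ}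
    {hn : ℕ → ℝ → ℂ} {Ψ : ℝ → ℝ → ℂ} {Ψn : ℕ → ℝ → ℝ → ℂ} {M T : ℝ} (hM : 0 ≤ M)
    (hsupp : suppPos h ⊆ Icc 0 M) (hsuppn : ∀ n, suppPos (hn n) ⊆ Icc 0 M)
    (hhconv : TendstoUniformlyOn hn h atTop (Icc 0 M))
    (hΨ : IsRiccatiSolution ρ η lam w K h Ψ)
    (hΨn : ∀ n, IsRiccatiSolution ρ η lam w (Kn n) (hn n) (Ψn n))
    (hcont : ContinuousOn (psi K Ψ) (Icc 0 T))
    (hψ : TendstoUniformlyOn (fun n => psi (Kn n) (Ψn n)) (psi K Ψ) atTop (Icc 0 T)) :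
    TendstoUniformlyOn (fun n (p : ℝ × ℝ) => Ψn n p.1 p.2) (fun p => Ψ p.1 p.2) atTop
      (Icc 0 T ×ˢ Icc 0 (M + T)) := by
  obtain ⟨Bψ, hBψ⟩ := isCompact_Icc.exists_bound_of_continuousOn hcont
  obtain ⟨L, hL0, hL⟩ := exists_norm_riccatiR_sub_le ρ η lam w Bψ
  rw [Metric.tendstoUniformlyOn_iff] at hhconv hψ ⊢
  intro e he
  -- The minimum with $1$ keeps $\psi^n$ in the range of the local Lipschitz bound; each branch of
  -- the profile then contributes at most $e/4$.
  filter_upwards [hhconv (e / 4) (by positivity),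
    hψ (min 1 (e / (4 * (L + 1)))) (lt_min one_pos (by positivity))] with n hhn hψn p hp
  obtain ⟨⟨ht0, htT⟩, hξ0, hξ⟩ := hp
  rw [dist_comm, dist_eq_norm, hΨ.eq_profile ht0 hξ0, (hΨn n).eq_profile ht0 hξ0]
  have hle := norm_profile_sub_le (ρ := ρ) (η := η) (lam := lam) (w := w) (ψ := psi K Ψ)
    (ψ' := psi (Kn n) (Ψn n)) (s := p.1 - p.2) (σ := e / 4) (e := e / 4) hM hsupp (hsuppn n)
    (by positivity) (fun x hx => by
      have := (hhn x hx).le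
      rwa [dist_comm, dist_eq_norm] at this) (by positivity) (by
      intro hs
      have hmem : p.1 - p.2 ∈ Icc 0 T := ⟨hs.le, by linarith⟩
      have h1 := (hψn _ hmem).le
      rw [dist_comm, dist_eq_norm] at h1
      calc _ ≤ L * ‖psi (Kn n) (Ψn n) (p.1 - p.2) - psi K Ψ (p.1 - p.2)‖ :=
            hL _ _ (hBψ _ hmem) (h1.trans (min_le_left _ _))
        _ ≤ (L + 1) * (e / (4 * (L + 1))) := by
            gcongr
            · linarith
            · exact h1.trans (min_le_right _ _)
        _ = e / 4 := by field_simp)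
  linarith

end VolterraHeston

theorem mainTheorem9
    -- model parameters
    (ρ η lam : ℝ) (hρ : ρ ∈ Icc (-1 : ℝ) 1) (hη : 0 ≤ η) (hlam : 0 ≤ lam)
    -- the kernel `K` and the approximating kernels `Kn n`
    (γ₀ γ : ℝ) (c₀ c : ℝ → ℝ) (K : ℝ → ℝ) (Kn : ℕ → ℝ → ℝ)
    (hK : IsAdmissibleKernel γ₀ c₀ K)
    (hKn : ∀ n, IsAdmissibleKernel γ c (Kn n))
    (hKconv : ∀ S : ℝ,
      Tendsto (fun n => eLpNorm (Kn n - K) 2 (volume.restrict (Icc 0 S))) atTop (𝓝 0))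
    -- horizon, Fourier-Laplace argument and initial conditions
    (T : ℝ) (hT : 0 ≤ T) (w : ℂ) (hw : w.re ∈ Icc (0 : ℝ) 1)
    (h : ℝ → ℂ) (hn : ℕ → ℝ → ℂ)
    (hh : MemGstar γ₀ K h) (hhn : ∀ n, MemGstar γ (Kn n) (hn n))
    (M : ℝ) (hM : 0 ≤ M)
    (hsupp : suppPos h ⊆ Icc 0 M) (hsuppn : ∀ n, suppPos (hn n) ⊆ Icc 0 M)
    (hhconv : TendstoUniformlyOn hn h atTop (Icc 0 M))
    -- solutions of the Riccati equations
    (Ψ : ℝ → ℝ → ℂ) (Ψn : ℕ → ℝ → ℝ → ℂ)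
    (hΨ : IsRiccatiSolution ρ η lam w K h Ψ)
    (hΨn : ∀ n, IsRiccatiSolution ρ η lam w (Kn n) (hn n) (Ψn n)) :
    -- `ψⁿ → ψ` in `C[0,T]`
    (ContinuousOn (psi K Ψ) (Icc 0 T) ∧ (∀ n, ContinuousOn (psi (Kn n) (Ψn n)) (Icc 0 T)) ∧
      TendstoUniformlyOn (fun n => psi (Kn n) (Ψn n)) (psi K Ψ) atTop (Icc 0 T)) ∧
    -- supports
    (∀ t ∈ Icc 0 T, suppPos (Ψ t) ⊆ Icc 0 (M + T) ∧
      ∀ n, suppPos (Ψn n t) ⊆ Icc 0 (M + T)) ∧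
    -- `Ψⁿ(t,·) → Ψ(t,·)` in the space of bounded functions on `[0, M+T]`, uniformly in `t ∈ [0,T]`
    (∀ t ∈ Icc 0 T, MemB (Icc 0 (M + T)) (Ψ t) ∧ ∀ n, MemB (Icc 0 (M + T)) (Ψn n t)) ∧
    TendstoUniformlyOn (fun n (p : ℝ × ℝ) => Ψn n p.1 p.2) (fun p => Ψ p.1 p.2) atTop
      (Icc 0 T ×ˢ Icc 0 (M + T)) := by
  have hcont : ContinuousOn (psi K Ψ) (Icc 0 T) :=
    hΨ.continuousOn_psi hK.memL2loc hK.kernelMonotone hh.1 hM hsupp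
  have hψ := tendstoUniformlyOn_psi (T := T) hK.memL2loc hK.kernelMonotone
    (fun n => (hKn n).memL2loc) (fun n => (hKn n).kernelMonotone) (hKconv (M + T)) hh.1
    (fun n => (hhn n).1) hM hsupp hsuppn hhconv hΨ hΨn
  refine ⟨⟨hcont, fun n => ?_, hψ⟩, fun t ht => ⟨?_, fun n => ?_⟩, fun t ht => ⟨?_, fun n => ?_⟩, ?_⟩
  · exact (hΨn n).continuousOn_psi (hKn n).memL2loc (hKn n).kernelMonotone (hhn n).1 hM (hsuppn n)
  · exact hΨ.suppPos_subset hM hsupp ht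
  · exact (hΨn n).suppPos_subset hM (hsuppn n) ht
  · exact hΨ.memB hK.memL2loc hK.kernelMonotone hh.1 hM hsupp ht
  · exact (hΨn n).memB (hKn n).memL2loc (hKn n).kernelMonotone (hhn n).1 hM (hsuppn n) ht
  · exact tendstoUniformlyOn_solution hM hsupp hsuppn hhconv hΨ hΨn hcont hψ
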